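/- **Definitions.** A *string $C$-group of rank $r$* is a group $G$ together with an ordered set $S=\{\rho_0,\dots,\rho_{r-1}\}$ of $r$ distinct involutions generating $G$ such that $\langle M\rangle\cap\langle N\rangle=\langle M\cap N\rangle$ for all $M,N\subseteq S$, and $(\rho_i\rho_j)^2=1$ whenever $|i-j|>1$. The *permutation representation graph* of permutations $\rho_0,\dots,\rho_{r-1}$ of a set $V$ is the edge-labelled multigraph on $V$ with an $i$-edge $\{a,b\}$ whenever $a\ne b$ and $\rho_i$ maps one of $a,b$ to the other. Let $r\ge 1$ and let $V$ consist of two rows of $r$ vertices, with columns numbered $1,\dots,r$. Consider the following edge-labelled graphs on $V$. * *Horizontal edges* (in all six graphs): for $1\le i\le r-1$, in both rows an $i$-edge joins the vertices in columns $i$ and $i+1$. * *Vertical $0$-edges*: in graphs (1) and (2), a $0$-edge joins the two vertices of each column; in graphs (13) and (15), a $0$-edge joins the two vertices of column $1$ only; in graphs (14) and (16), a $0$-edge joins the two vertices of each of the columns $2,\dots,r$. * *Further vertical edges* (only in graphs (2), (15), (16)): for $1\le i\le r-1$, an $i$-edge joins the two vertices of each column other than $i$ and $i+1$. (For $r\ge3$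 this makes $\langle\rho_1,\dots,\rho_{r-1}\rangle\cong\mathrm{Sym}(r)$ act transitively on the $2r$ points.) **Proposition.** Each of the graphs (1), (2), (13), (15) for every $r\ge1$, the graph (14) for every $r\ge2$, and the graph (16) for every even $r\ge2$, is the permutation representation graph of some permutations $\rho_0,\dots,\rho_{r-1}$ of $V$; and whenever permutations $\rho_0,\dots,\rho_{r-1}$ of $V$ have this graph as their permutation representation graph, the group $\langle\rho_0,\dots,\rho_{r-1}\rangle$ with $S=\{\rho_0,\dots,\rho_{r-1}\}$ is a string $C$-group of rank $r$. -/

import Mathlib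

/-- A `C`-group `(G, S)`: `S` is a finite set of involutions generating `G`, with the
intersection property. -/
structure IsCGroup (G : Type*) [Group G] (S : Set G) : Prop where
  finite : S.Finite
  involution : ∀ s ∈ S, orderOf s = 2
  generate : Subgroup.closure S = ⊤
  intersection : ∀ M N : Set G, M ⊆ S → N ⊆ S →
    Subgroup.closure M ⊓ Subgroup.closure N = Subgroup.closure (M ∩ N)

/-- `(G, {ρ 0, …, ρ (r-1)})` is a string `C`-group of rank `r`: the `ρ i` are pairwise distinct,
they form a `C`-group, and `(ρ i * ρ j) ^ 2 = 1` whenever `|i - j| > 1`. -/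
structure IsStringCGroup (G : Type*) [Group G] {r : ℕ} (ρ : Fin r → G) : Prop where
  rank_eq : Function.Injective ρ
  isCGroup : IsCGroup G (Set.range ρ)
  string : ∀ i j : Fin r, 1 < |((i : ℕ) : ℤ) - ((j : ℕ) : ℤ)| → (ρ i * ρ j) ^ 2 = 1

/-- The permutation group `⟨ρ 0, …, ρ (r-1)⟩`. -/
def permGroup {V : Type*} {r : ℕ} (ρ : Fin r → Equiv.Perm V) : Subgroup (Equiv.Perm V) :=
  Subgroup.closure (Set.range ρ)

/-- The permutations `ρ i`, seen as elements of the group that they generate. -/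
def permGens {V : Type*} {r : ℕ} (ρ : Fin r → Equiv.Perm V) (i : Fin r) : permGroup ρ :=
  ⟨ρ i, Subgroup.subset_closure (Set.mem_range_self i)⟩

/-- A multigraph on `V` with edge labels in `{0, …, r-1}` (no loops, no two edges with the same
ends and the same label), given by the simple graph of its `i`-edges for each label `i`. -/
abbrev LabelledGraph (V : Type*) (r : ℕ) : Type _ := Fin r → SimpleGraph V

/-- The permutation representation graph of a tuple of permutations: `a` and `b` are joined by an
`i`-edge when `a ≠ b` and `ρ i` takes one of `a`, `b` to the other. -/
def permRepGraph {V : Type*} {r : ℕ} (ρ : Fin r → Equiv.Perm V) : LabelledGraph V r :=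
  fun i => SimpleGraph.fromRel fun a b => ρ i a = b

/-- Two rows and `r` columns `0, …, r-1`; the vertex in column `c` and row `t` is `(c, t)`.
* The `0`-edges are the vertical edges in the columns `c` with `F c`.
* For `1 ≤ i ≤ r-1`, both rows have a horizontal `i`-edge between the columns `i-1` and `i`. -/
def ladder (r : ℕ) (F : Fin r → Prop) : LabelledGraph (Fin r × Fin 2) r :=
  fun i => SimpleGraph.fromRel fun a b =>
    ((i : ℕ) = 0 ∧ F a.1 ∧ a.1 = b.1) ∨
    ((i : ℕ) ≠ 0 ∧ (a.1 : ℕ) + 1 = i ∧ (b.1 : ℕ) = i ∧ a.2 = b.2)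

/-- The graph `ladder r F`, where moreover for each `1 ≤ i ≤ r-1` there is a vertical `i`-edge in
every column other than `i-1` and `i`. -/
def twistedLadder (r : ℕ) (F : Fin r → Prop) : LabelledGraph (Fin r × Fin 2) r :=
  fun i => ladder r F i ⊔ SimpleGraph.fromRel fun a b =>
    (i : ℕ) ≠ 0 ∧ (a.1 : ℕ) + 1 ≠ i ∧ (a.1 : ℕ) ≠ i ∧ a.1 = b.1

/-- Graph (1): vertical `0`-edges in all columns. -/
def graph1 (r : ℕ) : LabelledGraph (Fin r × Fin 2) r := ladder r fun _ => True

/-- Graph (2): as graph (1), with `ρ 1, …, ρ (r-1)` generating the symmetric group of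
degree `r` in its transitive action on `2 * r` points (for `r ≥ 3`). -/
def graph2 (r : ℕ) : LabelledGraph (Fin r × Fin 2) r := twistedLadder r fun _ => True

/-- Graph (13): one vertical `0`-edge, in the first column. -/
def graph13 (r : ℕ) : LabelledGraph (Fin r × Fin 2) r := ladder r fun c => (c : ℕ) = 0

/-- Graph (14): vertical `0`-edges in all columns but the first. -/
def graph14 (r : ℕ) : LabelledGraph (Fin r × Fin 2) r := ladder r fun c => (c : ℕ) ≠ 0

/-- Graph (15): the `0`-edge of graph (13), and the other edges of graph (2). -/
def graph15 (r : ℕ) : LabelledGraph (Fin r × Fin 2) r := twistedLadder r fun c => (c : ℕ) = 0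

/-- Graph (16): the `0`-edges of graph (14), and the other edges of graph (2). -/
def graph16 (r : ℕ) : LabelledGraph (Fin r × Fin 2) r := twistedLadder r fun c => (c : ℕ) ≠ 0

/-- The graph `𝒢` is the permutation representation graph of a tuple of permutations, and every
such tuple, with the group that it generates, is a string `C`-group of rank `r`. -/
def GivesStringCGroup {V : Type*} {r : ℕ} (𝒢 : LabelledGraph V r) : Prop :=
  (∃ ρ : Fin r → Equiv.Perm V, permRepGraph ρ = 𝒢) ∧
  ∀ ρ : Fin r → Equiv.Perm V, permRepGraph ρ = 𝒢 → IsStringCGroup (permGroup ρ) (permGens ρ)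

/-! Read the two vertices of column `c` as plus and minus the `c`-th unit vector; signed
permutations are then the symmetries of the cross-polytope, the Coxeter group of type B_r. The
generators for `graph13` to `graph16` are images of its Coxeter generators; those for `graph1` and
`graph2` are images of generators of Sym(r) × C₂. The map is `twist`: multiply by the central row
interchange where a character is -1, then conjugate by a diagonal sign change. Conjugation by
`colParity` cancels the interchange on the two columns that a transposition moves, leaving vertical
edges in the others.

The intersection property comes from `isStringCGroup_of_hom`. In type B_r, `mem_closure_coxGen`
shows by sorting that every standard parabolic subgroup is an intersection of face stabilizers.
`twist` can identify only elements that agree up to the row interchange, and elements of face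
stabilizers with equal images are equal, so intersections of images lift. Finally, involutions are
determined by their graph, so one tuple per graph is enough. -/

open Equiv

/-! ### Reduction to one tuple, and the lifting criterion. -/

/-- The permutations of `V` with a given labelled graph of involutions are determined by it. -/
theorem eq_of_permRepGraph_eq {V : Type*} {r : ℕ} {ρ τ : Fin r → Perm V}
    (hτ : ∀ i, τ i ^ 2 = 1) (h : permRepGraph ρ = permRepGraph τ) : ρ = τ := by
  funext i
  ext a
  have hinv : ∀ v, τ i (τ i v) = v := fun v => by
    simpa [pow_two] using congrArg (fun g : Perm V => g v) (hτ i)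
  have hadj : ∀ a b, (a ≠ b ∧ (ρ i a = b ∨ ρ i b = a)) ↔ (a ≠ b ∧ (τ i a = b ∨ τ i b = a)) := by
    intro a b
    have := congrFun h i
    simpa [permRepGraph] using congrArg (fun G : SimpleGraph V => G.Adj a b) this
  by_cases h1 : ρ i a = a
  · by_contra h2
    rw [h1] at h2
    rcases ((hadj a (τ i a)).2 ⟨h2, Or.inl rfl⟩).2 with h3 | h3
    · exact h2 (h1.symm.trans h3)
    · exact h2 ((ρ i).injective (h1.trans h3.symm))
  · rcases ((hadj a (ρ i a)).1 ⟨fun h => h1 h.symm, Or.inl rfl⟩).2 with h3 | h3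
    · exact h3.symm
    · rw [← hinv (ρ i a), h3]

theorem givesStringCGroup_of_exists {V : Type*} {r : ℕ} {𝒢 : LabelledGraph V r}
    (τ : Fin r → Perm V) (hg : permRepGraph τ = 𝒢)
    (hs : IsStringCGroup (permGroup τ) (permGens τ)) : GivesStringCGroup 𝒢 := by
  refine ⟨⟨τ, hg⟩, fun ρ hρ => ?_⟩
  have hτ : ∀ i, τ i ^ 2 = 1 := fun i => by
    have := pow_orderOf_eq_one (permGens τ i)
    rw [hs.isCGroup.involution _ ⟨i, rfl⟩] at this
    simpa [permGens] using congrArg Subtype.val this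
  obtain rfl := eq_of_permRepGraph_eq hτ (hρ.trans hg.symm)
  exact hs

/-- A criterion for the images `φ (e i)` to generate a string `C`-group, in terms of subgroups
`Q j` whose intersections are the subgroups generated by subsets of the `e i`. -/
theorem isStringCGroup_of_hom {E V : Type*} [Group E] {r : ℕ} (φ : E →* Perm V) (e : Fin r → E)
    (Q : Fin r → Subgroup E) (hQ : ∀ i j, i ≠ j → e i ∈ Q j)
    (hcl : ∀ (I : Set (Fin r)) (x : E), (∀ j ∉ I, x ∈ Q j) → x ∈ Subgroup.closure (e '' I))
    (hlift : ∀ (I : Set (Fin r)) (y : Perm V), (∃ j, j ∉ I) → (∀ j ∉ I, ∃ x ∈ Q j, φ x = y) →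
      ∃ x, (∀ j ∉ I, x ∈ Q j) ∧ φ x = y)
    (hsq : ∀ i, e i ^ 2 = 1) (hne : ∀ i, φ (e i) ≠ 1)
    (hinj : Function.Injective fun i => φ (e i))
    (hstr : ∀ i j : Fin r, 1 < |((i : ℕ) : ℤ) - ((j : ℕ) : ℤ)| → (e i * e j) ^ 2 = 1) :
    IsStringCGroup (permGroup fun i => φ (e i)) (permGens fun i => φ (e i)) := by
  set ρ : Fin r → Perm V := fun i => φ (e i) with hρ
  have hgi : Function.Injective (permGens ρ) := fun i j h => hinj (congrArg Subtype.val h)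
  have hgen : Subgroup.closure (Set.range (permGens ρ)) = ⊤ := by
    have h1 : Subgroup.closure ((↑) ⁻¹' Set.range ρ : Set (permGroup ρ)) = ⊤ :=
      Subgroup.closure_closure_coe_preimage
    have h2 : Set.range (permGens ρ) = (↑) ⁻¹' Set.range ρ := by
      ext x
      simp only [Set.mem_range, Set.mem_preimage, permGens, Subtype.ext_iff]
    rw [h2, h1]
  have hmem : ∀ (I : Set (Fin r)) (x : permGroup ρ),
      x ∈ Subgroup.closure (permGens ρ '' I) ↔ ∃ y ∈ Subgroup.closure (e '' I), φ y = x := by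
    intro I x
    have h1 : (Subgroup.closure (permGens ρ '' I)).map (permGroup ρ).subtype
        = (Subgroup.closure (e '' I)).map φ := by
      rw [MonoidHom.map_closure, MonoidHom.map_closure, Set.image_image, Set.image_image]
      rfl
    have h2 : x ∈ Subgroup.closure (permGens ρ '' I) ↔
        (x : Perm V) ∈ (Subgroup.closure (permGens ρ '' I)).map (permGroup ρ).subtype := by
      simp
    rw [h2, h1, Subgroup.mem_map]
  refine ⟨hgi, ⟨Set.finite_range _, ?_, hgen, ?_⟩, ?_⟩
  · rintro _ ⟨i, rfl⟩
    refine orderOf_eq_prime ?_ ?_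
    · ext1
      simp [permGens, hρ, ← map_pow, hsq]
    · exact fun h => hne i (congrArg Subtype.val h)
  · intro M N hM hN
    obtain ⟨I, rfl⟩ := Set.subset_range_iff_exists_image_eq.1 hM
    obtain ⟨J, rfl⟩ := Set.subset_range_iff_exists_image_eq.1 hN
    rw [← Set.image_inter hgi]
    refine le_antisymm ?_ (le_inf (Subgroup.closure_mono (Set.image_mono Set.inter_subset_left))
      (Subgroup.closure_mono (Set.image_mono Set.inter_subset_right)))
    rintro x ⟨hx, hx'⟩
    by_cases hIJ : ∃ j, j ∉ I ∩ J
    · obtain ⟨y, hy, hyx⟩ := (hmem I x).1 hx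
      obtain ⟨z, hz, hzx⟩ := (hmem J x).1 hx'
      have hle : ∀ (K : Set (Fin r)) (j), j ∉ K → Subgroup.closure (e '' K) ≤ Q j := by
        intro K j hj
        rw [Subgroup.closure_le]
        rintro _ ⟨i, hi, rfl⟩
        exact hQ i j fun h => hj (h ▸ hi)
      -- Each `j` outside `I ∩ J` is missing from `I` or from `J`, so one of the two preimages `y`,
      -- `z` lies in `Q j`; `hlift` merges these into a single preimage.
      obtain ⟨w, hw, hwx⟩ := hlift (I ∩ J) x hIJ fun j hj => by
        by_cases hjI : j ∈ I
        · exact ⟨z, hle J j (fun hjJ => hj ⟨hjI, hjJ⟩) hz, hzx⟩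
        · exact ⟨y, hle I j hjI hy, hyx⟩
      exact (hmem _ x).2 ⟨w, hcl _ w hw, hwx⟩
    · push Not at hIJ
      rw [Set.eq_univ_of_forall hIJ, Set.image_univ, hgen]
      trivial
  · intro i j hij
    ext1
    simp [permGens, hρ, ← map_mul, ← map_pow, hstr i j hij]

/-! ### Signed permutations of the columns. -/

/-- The signed permutation `(c, t) ↦ (σ c, t + f c)` of the two-row array. -/
def signedPerm {r : ℕ} (σ : Perm (Fin r)) (f : Fin r → Fin 2) : Perm (Fin r × Fin 2) :=
  Equiv.prodShear σ fun c => Equiv.addRight (f c)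

@[simp]
theorem signedPerm_apply {r : ℕ} (σ : Perm (Fin r)) (f : Fin r → Fin 2) (v : Fin r × Fin 2) :
    signedPerm σ f v = (σ v.1, v.2 + f v.1) := rfl

theorem signedPerm_mul {r : ℕ} (σ τ : Perm (Fin r)) (f g : Fin r → Fin 2) :
    signedPerm σ f * signedPerm τ g = signedPerm (σ * τ) fun c => g c + f (τ c) := by
  ext1 v
  simp [add_assoc]

theorem signedPerm_one {r : ℕ} : signedPerm (1 : Perm (Fin r)) (fun _ => 0) = 1 := by
  ext1 v
  simp

theorem fin_two_add_self (t : Fin 2) : t + t = 0 := by revert t; decide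

/-- The group of signed permutations, as pairs consisting of a permutation of the two-row array
and the permutation of the columns that it induces. -/
def signedGroup (r : ℕ) : Subgroup (Perm (Fin r × Fin 2) × Perm (Fin r)) where
  carrier := {p | ∀ v, (p.1 v).1 = p.2 v.1}
  one_mem' _ := rfl
  mul_mem' {p q} hp hq v := by
    simp only [Set.mem_ofPred_eq] at hp hq
    simp [hp, hq]
  inv_mem' {p} hp v := by
    simp only [Set.mem_ofPred_eq] at hp
    have := hp (p.1⁻¹ v)
    rw [← Perm.mul_apply, mul_inv_cancel, Perm.one_apply] at this
    simp [this]

/-- The signed permutation `(c, t) ↦ (σ c, t + f c)` as an element of the signed group. -/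
def toSigned {r : ℕ} (σ : Perm (Fin r)) (f : Fin r → Fin 2) : signedGroup r :=
  ⟨(signedPerm σ f, σ), fun _ => rfl⟩

/-- Each column is carried bijectively onto a column, and a bijection between two-element rows is a
shift, read off from row `0`. -/
theorem exists_eq_toSigned {r : ℕ} (b : signedGroup r) : ∃ σ f, b = toSigned σ f := by
  refine ⟨b.1.2, fun c => (b.1.1 (c, 0)).2, ?_⟩
  refine Subtype.ext (Prod.ext (Equiv.ext ?_) rfl)
  rintro ⟨c, t⟩
  refine Prod.ext (b.2 _) ?_
  show (b.1.1 (c, t)).2 = t + (b.1.1 (c, 0)).2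
  have h : ∀ t, (b.1.1 (c, t)).1 = b.1.2 c := fun t => b.2 (c, t)
  have hne : (b.1.1 (c, 1)).2 ≠ (b.1.1 (c, 0)).2 := fun h2 => by
    have := b.1.1.injective (Prod.ext ((h 1).trans (h 0).symm) h2)
    simp at this
  match t with
  | 0 => simp
  | 1 =>
    revert hne
    generalize (b.1.1 (c, 1)).2 = x
    generalize (b.1.1 (c, 0)).2 = y
    revert x y
    decide

theorem toSigned_mul {r : ℕ} (σ τ : Perm (Fin r)) (f g : Fin r → Fin 2) :
    toSigned σ f * toSigned τ g = toSigned (σ * τ) fun c => g c + f (τ c) :=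
  Subtype.ext (Prod.ext (signedPerm_mul σ τ f g) rfl)

theorem toSigned_one {r : ℕ} : toSigned (1 : Perm (Fin r)) (fun _ => 0) = 1 :=
  Subtype.ext (Prod.ext signedPerm_one rfl)

/-! ### Coxeter generators of type B_r. -/

/-- The transposition of the columns `i - 1` and `i`; trivial for `i = 0`. -/
def colSwap {r : ℕ} (i : Fin r) : Perm (Fin r) :=
  swap ⟨i - 1, lt_of_le_of_lt (Nat.sub_le _ _) i.2⟩ i

theorem colSwap_val {r : ℕ} (i c : Fin r) : (colSwap i c : ℕ) =
    if (c : ℕ) + 1 = i then (i : ℕ) else if c = i then (i : ℕ) - 1 else c := by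
  have := i.2
  unfold colSwap
  rw [swap_apply_def]
  simp only [Fin.ext_iff, apply_ite Fin.val]
  split_ifs <;> omega

theorem colSwap_of_zero {r : ℕ} (i : Fin r) (h : (i : ℕ) = 0) : colSwap i = 1 := by
  ext c
  show (colSwap i c : ℕ) = c
  rw [colSwap_val]
  split_ifs with h1 h2
  · omega
  · rw [h2]
    omega
  · rfl

theorem colSwap_sq {r : ℕ} (i : Fin r) : colSwap i * colSwap i = 1 := swap_mul_self _ _

theorem colSwap_injective {r : ℕ} : Function.Injective (colSwap (r := r)) := by
  intro i j h
  have h1 := congrArg (fun g : Perm (Fin r) => (g i : ℕ)) h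
  have h2 := congrArg (fun g : Perm (Fin r) => (g j : ℕ)) h
  simp only [colSwap_val] at h1 h2
  ext
  simp only [Fin.ext_iff] at h1 h2
  split_ifs at h1 h2 <;> omega

theorem sign_colSwap {r : ℕ} (i : Fin r) :
    Perm.sign (colSwap i) = if (i : ℕ) = 0 then 1 else -1 := by
  split_ifs with h
  · rw [colSwap_of_zero i h, map_one]
  · exact Perm.sign_swap (by simp only [ne_eq, Fin.ext_iff]; omega)

theorem colSwap_comm {r : ℕ} (i j : Fin r) (h : 1 < |((i : ℕ) : ℤ) - ((j : ℕ) : ℤ)|) :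
    colSwap i * colSwap j = colSwap j * colSwap i := by
  ext c
  have h' : (i : ℕ) + 1 < j ∨ (j : ℕ) + 1 < i := by
    rcases lt_abs.1 h with h | h <;> omega
  simp only [Perm.mul_apply, colSwap_val, Fin.ext_iff]
  split_ifs <;> omega

/-- The standard Coxeter generators of the signed group: the sign change of the first column, and
the transpositions of neighbouring columns. -/
def coxGen {r : ℕ} (i : Fin r) : signedGroup r :=
  toSigned (colSwap i) fun c => if (i : ℕ) = 0 ∧ (c : ℕ) = 0 then 1 else 0

theorem coxGen_sq {r : ℕ} (i : Fin r) : coxGen i ^ 2 = 1 := by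
  rw [pow_two, coxGen, toSigned_mul, colSwap_sq, ← toSigned_one]
  congr 1
  funext c
  by_cases h : (i : ℕ) = 0
  · simp [h, colSwap_of_zero i h, fin_two_add_self]
  · simp [h]

theorem coxGen_comm {r : ℕ} (i j : Fin r) (h : 1 < |((i : ℕ) : ℤ) - ((j : ℕ) : ℤ)|) :
    coxGen i * coxGen j = coxGen j * coxGen i := by
  have h' : (i : ℕ) + 1 < j ∨ (j : ℕ) + 1 < i := by
    rcases lt_abs.1 h with h | h <;> omega
  rw [coxGen, coxGen, toSigned_mul, toSigned_mul, colSwap_comm i j h]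
  congr 1
  funext c
  simp only [colSwap_val, Fin.ext_iff]
  split_ifs <;> first | rfl | omega

theorem mul_sq_of_comm {G : Type*} [Group G] {a b : G} (ha : a ^ 2 = 1) (hb : b ^ 2 = 1)
    (h : a * b = b * a) : (a * b) ^ 2 = 1 := by
  rw [Commute.mul_pow h, ha, hb, one_mul]

/-! ### Face stabilizers, and generation of parabolic subgroups by sorting. -/

/-- The stabilizer of the face `{(c, 0) : j ≤ c}`. -/
def faceStab {r : ℕ} (j : Fin r) : Subgroup (signedGroup r) where
  carrier := {b | ∀ v, (j ≤ (b.1.1 v).1 ∧ (b.1.1 v).2 = 0) ↔ (j ≤ v.1 ∧ v.2 = 0)}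
  one_mem' _ := Iff.rfl
  mul_mem' {a b} ha hb v := (ha _).trans (hb v)
  inv_mem' {a} ha v := by
    have := ha (a.1.1⁻¹ v)
    rw [← Perm.mul_apply, mul_inv_cancel, Perm.one_apply] at this
    exact this.symm

theorem toSigned_mem_faceStab {r : ℕ} {j : Fin r} {σ : Perm (Fin r)} {f : Fin r → Fin 2} :
    toSigned σ f ∈ faceStab j ↔ ∀ c, (j ≤ σ c ↔ j ≤ c) ∧ (j ≤ c → f c = 0) := by
  show (∀ v : Fin r × Fin 2, (j ≤ σ v.1 ∧ v.2 + f v.1 = 0) ↔ (j ≤ v.1 ∧ v.2 = 0)) ↔ _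
  constructor
  · intro h c
    have h0 := h (c, 0)
    have h1 := h (c, f c)
    simp only [fin_two_add_self, zero_add, and_true] at h0 h1
    tauto
  · intro h v
    obtain ⟨h1, h2⟩ := h v.1
    rw [h1]
    refine and_congr_right fun hj => ?_
    rw [h2 hj, add_zero]

theorem coxGen_mem_faceStab {r : ℕ} {i j : Fin r} (h : i ≠ j) : coxGen i ∈ faceStab j := by
  rw [coxGen, toSigned_mem_faceStab]
  intro c
  have h' : (i : ℕ) ≠ j := fun h2 => h (Fin.ext h2)
  simp only [Fin.le_def, colSwap_val, Fin.ext_iff]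
  constructor
  · split_ifs <;> omega
  · intro hj
    rw [if_neg]
    omega

/-- The signed value `± (d + 1)` that a signed permutation takes at the column `c`. -/
def signedValue {r : ℕ} (σ : Perm (Fin r)) (f : Fin r → Fin 2) (c : Fin r) : ℤ :=
  if f c = 0 then (σ c : ℤ) + 1 else -((σ c : ℤ) + 1)

/-- Without a descent the signed values are positive and strictly increasing, so the one at column
`n` is at least `n + 1`. Hence there are no sign changes and `c ≤ σ c` throughout. -/
theorem exists_descent {r : ℕ} (σ : Perm (Fin r)) (f : Fin r → Fin 2) (h : toSigned σ f ≠ 1) :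
    ∃ i : Fin r, ((i : ℕ) = 0 ∧ signedValue σ f i < 0) ∨
      ∃ k : Fin r, (k : ℕ) + 1 = i ∧ signedValue σ f i < signedValue σ f k := by
  by_contra! hno
  apply h
  have hge : ∀ n : ℕ, ∀ hn : n < r, (n : ℤ) + 1 ≤ signedValue σ f ⟨n, hn⟩ := by
    intro n
    induction n with
    | zero =>
      intro hn
      have := (hno ⟨0, hn⟩).1 rfl
      unfold signedValue at this ⊢
      split_ifs at this ⊢ <;> push_cast <;> omega
    | succ n ih =>
      intro hn
      have h1 := ih (by omega)
      have h2 := (hno ⟨n + 1, hn⟩).2 ⟨n, by omega⟩ rfl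
      have h3 : signedValue σ f ⟨n, by omega⟩ ≠ signedValue σ f ⟨n + 1, hn⟩ := by
        intro heq
        have : (σ ⟨n, by omega⟩ : ℕ) = σ ⟨n + 1, hn⟩ := by
          unfold signedValue at heq
          split_ifs at heq <;> omega
        simpa using σ.injective (Fin.ext this)
      have h4 := lt_of_le_of_ne h2 h3
      push_cast
      omega
  have hf : ∀ c, f c = 0 := by
    intro c
    have := hge c c.2
    unfold signedValue at this
    by_contra hc
    rw [if_neg hc] at this
    omega
  have hle : ∀ c ∈ (Finset.univ : Finset (Fin r)), (c : ℕ) ≤ (σ c : ℕ) := by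
    intro c _
    have := hge c c.2
    simp only [signedValue, hf, if_true, Fin.eta] at this
    omega
  -- A permutation preserves the sum of the column numbers, so all the inequalities are equalities.
  have heq := (Finset.sum_eq_sum_iff_of_le hle).1 (Equiv.sum_comp σ fun c : Fin r => (c : ℕ)).symm
  rw [← toSigned_one]
  congr 1
  · ext c
    exact (heq c (Finset.mem_univ c)).symm
  · exact funext hf

/-- A weighted sum of signed values, which sorting increases. -/
def sortPotential {r : ℕ} (b : signedGroup r) : ℤ :=
  ∑ c : Fin r, ((c : ℤ) + 1) * signedValue b.1.2 (fun c => (b.1.1 (c, 0)).2) c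

theorem sortPotential_toSigned {r : ℕ} (σ : Perm (Fin r)) (f : Fin r → Fin 2) :
    sortPotential (toSigned σ f) = ∑ c : Fin r, ((c : ℤ) + 1) * signedValue σ f c := by
  simp [sortPotential, toSigned]

theorem sortPotential_lt_of_neg {r : ℕ} (σ : Perm (Fin r)) (f : Fin r → Fin 2) (i : Fin r)
    (hi : (i : ℕ) = 0) (h : signedValue σ f i < 0) :
    sortPotential (toSigned σ f) < sortPotential (toSigned σ f * coxGen i) := by
  rw [coxGen, toSigned_mul, sortPotential_toSigned, sortPotential_toSigned, ← sub_pos,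
    ← Finset.sum_sub_distrib, colSwap_of_zero i hi, mul_one,
    Fintype.sum_eq_single i]
  · rw [← mul_sub]
    refine mul_pos (by positivity) ?_
    simp only [signedValue, hi, true_and, Perm.coe_one, id_eq, if_true] at h ⊢
    split_ifs at h with hf
    · omega
    · have : 1 + f i = 0 := by
        revert hf
        generalize f i = x
        revert x
        decide
      rw [if_pos this, if_neg hf]
      omega
  · intro c hc
    have hc' : (c : ℕ) ≠ 0 := fun h => hc (Fin.ext (h.trans hi.symm))
    simp [signedValue, hc']

/-- The swapped values have weights differing by 1, so the potential grows by exactly the size of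
the descent. -/
theorem sortPotential_lt_of_lt {r : ℕ} (σ : Perm (Fin r)) (f : Fin r → Fin 2) (i k : Fin r)
    (hk : (k : ℕ) + 1 = i) (h : signedValue σ f i < signedValue σ f k) :
    sortPotential (toSigned σ f) < sortPotential (toSigned σ f * coxGen i) := by
  have hi : (i : ℕ) ≠ 0 := by omega
  have hki : k ≠ i := fun h => by rw [h] at hk; omega
  have h1 : colSwap i k = i := Fin.ext (by rw [colSwap_val, if_pos hk])
  have h2 : colSwap i i = k := by
    rw [← h1, ← Perm.mul_apply]
    nth_rewrite 1 [h1]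
    rw [colSwap_sq, Perm.one_apply]
  rw [coxGen, toSigned_mul, sortPotential_toSigned, sortPotential_toSigned, ← sub_pos,
    ← Finset.sum_sub_distrib]
  have hv : ∀ c, signedValue (σ * colSwap i)
      (fun c => (if (i : ℕ) = 0 ∧ (c : ℕ) = 0 then 1 else 0) + f (colSwap i c)) c
      = signedValue σ f (colSwap i c) := by
    intro c
    simp [signedValue, hi]
  simp only [hv]
  rw [Fintype.sum_eq_add k i hki, h1, h2]
  · have : (i : ℤ) = k + 1 := by exact_mod_cast hk.symm
    rw [this]
    linarith
  · rintro c ⟨hck, hci⟩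
    have : colSwap i c = c := Fin.ext (by
      rw [colSwap_val, if_neg (fun h => hck (Fin.ext (by omega))), if_neg hci])
    rw [this, sub_self]

/-- The intersection of the stabilizers of the faces with label outside `I` is generated by the
Coxeter generators with label in `I`. -/
theorem mem_closure_coxGen {r : ℕ} (I : Set (Fin r)) (b : signedGroup r)
    (hb : ∀ j ∉ I, b ∈ faceStab j) : b ∈ Subgroup.closure (coxGen '' I) := by
  by_contra hbad
  -- Take a counterexample of maximal potential; removing a descent yields a larger one.
  obtain ⟨a, ⟨ha, hna⟩, hmax⟩ := Set.Finite.exists_maximalFor sortPotential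
    {b : signedGroup r | (∀ j ∉ I, b ∈ faceStab j) ∧ b ∉ Subgroup.closure (coxGen '' I)}
    (Set.toFinite _) ⟨b, hb, hbad⟩
  obtain ⟨σ, f, rfl⟩ := exists_eq_toSigned a
  have hne : toSigned σ f ≠ 1 := fun h => hna (h ▸ one_mem _)
  obtain ⟨i, hi⟩ := exists_descent σ f hne
  have hlt : sortPotential (toSigned σ f) < sortPotential (toSigned σ f * coxGen i) := by
    rcases hi with ⟨h0, h⟩ | ⟨k, hk, h⟩
    · exact sortPotential_lt_of_neg σ f i h0 h
    · exact sortPotential_lt_of_lt σ f i k hk h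
  -- If the face `i` were preserved, column `i` would have value at least `i + 1`, and earlier
  -- columns values at most `i`: no descent at `i`.
  have hiI : i ∈ I := by
    by_contra hiI
    have hst := toSigned_mem_faceStab.1 (ha i hiI)
    have hfi := (hst i).2 le_rfl
    have hσi := (hst i).1.2 le_rfl
    rcases hi with ⟨h0, h⟩ | ⟨k, hk, h⟩
    · rw [signedValue, if_pos hfi] at h
      omega
    · have hσk : ¬ i ≤ σ k := fun h => by
        have := (hst k).1.1 h
        rw [Fin.le_def] at this
        omega
      rw [Fin.le_def] at hσi hσk
      unfold signedValue at h
      rw [if_pos hfi] at h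
      split_ifs at h <;> omega
  have hgi : coxGen i ∈ Subgroup.closure (coxGen '' I) := Subgroup.subset_closure ⟨i, hiI, rfl⟩
  refine hlt.not_ge (hmax ⟨fun j hj => ?_, fun h => hna ?_⟩ hlt.le)
  · exact mul_mem (ha j hj) (coxGen_mem_faceStab fun h => hj (h ▸ hiI))
  · simpa using mul_mem h (inv_mem hgi)

/-! ### Twisting by a character and a diagonal sign change. -/

/-- The row shift by a sign: `0` for `1` and `1` for `-1`. -/
def rowShift (ε : ℤˣ) : Fin 2 := if ε = 1 then 0 else 1

theorem rowShift_mul (a b : ℤˣ) : rowShift (a * b) = rowShift a + rowShift b := by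
  revert a b
  decide

theorem rowShift_injective : Function.Injective rowShift := by
  intro a b
  revert a b
  decide

theorem signedPerm_inj {r : ℕ} {σ τ : Perm (Fin r)} {f g : Fin r → Fin 2}
    (h : signedPerm σ f = signedPerm τ g) : σ = τ ∧ f = g := by
  have h' := fun c => congrArg (fun p : Perm (Fin r × Fin 2) => p (c, 0)) h
  simp only [signedPerm_apply, Prod.mk.injEq, zero_add] at h'
  exact ⟨Equiv.ext fun c => (h' c).1, funext fun c => (h' c).2⟩

/-- The signed permutations `ι x`, multiplied by the interchange of the two rows when `χ x = -1`,
and conjugated by the sign change in the columns `c` with `o c = 1`. -/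
def twist {r : ℕ} {E : Type*} [Group E] (ι : E →* signedGroup r) (χ : E →* ℤˣ)
    (o : Fin r → Fin 2) : E →* Perm (Fin r × Fin 2) :=
  MonoidHom.mk' (fun x => signedPerm 1 o *
    (signedPerm 1 (fun _ => rowShift (χ x)) * (ι x).1.1) * signedPerm 1 o) <| by
  intro x y
  obtain ⟨σ, f, hσ⟩ := exists_eq_toSigned (ι x)
  obtain ⟨τ, g, hτ⟩ := exists_eq_toSigned (ι y)
  rw [map_mul, map_mul, hσ, hτ, toSigned_mul]
  simp only [toSigned, signedPerm_mul, one_mul, mul_one, rowShift_mul, Perm.one_apply]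
  congr 1
  funext c
  have := fin_two_add_self (o (τ c))
  calc _ = o c + (g c + f (τ c) + (rowShift (χ x) + rowShift (χ y))) + o ((σ * τ) c) := by abel
    _ = o c + (g c + f (τ c) + (rowShift (χ x) + rowShift (χ y))) + o ((σ * τ) c)
        + (o (τ c) + o (τ c)) := by rw [this, add_zero]
    _ = _ := by simp only [Perm.mul_apply]; abel

theorem twist_apply {r : ℕ} {E : Type*} [Group E] (ι : E →* signedGroup r) (χ : E →* ℤˣ)
    (o : Fin r → Fin 2) {x : E} {σ : Perm (Fin r)} {f : Fin r → Fin 2} (h : ι x = toSigned σ f) :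
    twist ι χ o x = signedPerm σ fun c => f c + rowShift (χ x) + (o c + o (σ c)) := by
  show signedPerm 1 o * (signedPerm 1 (fun _ => rowShift (χ x)) * (ι x).1.1) * signedPerm 1 o = _
  rw [h]
  simp only [toSigned, signedPerm_mul, one_mul, mul_one, Perm.one_apply]
  congr 1
  funext c
  abel

theorem twist_eq_twist {r : ℕ} {E : Type*} [Group E] {ι : E →* signedGroup r} {χ : E →* ℤˣ}
    {o : Fin r → Fin 2} {x y : E} {σ τ : Perm (Fin r)} {f g : Fin r → Fin 2}
    (hx : ι x = toSigned σ f) (hy : ι y = toSigned τ g) (h : twist ι χ o x = twist ι χ o y) :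
    σ = τ ∧ ∀ c, f c + rowShift (χ x) = g c + rowShift (χ y) := by
  rw [twist_apply ι χ o hx, twist_apply ι χ o hy] at h
  obtain ⟨rfl, h2⟩ := signedPerm_inj h
  exact ⟨rfl, fun c => add_right_cancel (congrFun h2 c)⟩

theorem isStringCGroup_twist_id {r : ℕ} (χ : signedGroup r →* ℤˣ) (o : Fin r → Fin 2)
    (hne : ∀ i, twist (MonoidHom.id _) χ o (coxGen i) ≠ 1) :
    IsStringCGroup (permGroup fun i => twist (MonoidHom.id _) χ o (coxGen i))
      (permGens fun i => twist (MonoidHom.id _) χ o (coxGen i)) := by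
  refine isStringCGroup_of_hom _ _ faceStab (fun i j h => coxGen_mem_faceStab h)
    mem_closure_coxGen ?_ coxGen_sq hne ?_ ?_
  · rintro I y ⟨k, hk⟩ hy
    obtain ⟨x, hxk, rfl⟩ := hy k hk
    refine ⟨x, fun j hj => ?_, rfl⟩
    obtain ⟨z, hzj, hz⟩ := hy j hj
    obtain ⟨σ, f, rfl⟩ := exists_eq_toSigned x
    obtain ⟨τ, g, rfl⟩ := exists_eq_toSigned z
    obtain ⟨rfl, hfg⟩ := twist_eq_twist rfl rfl hz
    have hf := toSigned_mem_faceStab.1 hxk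
    have hg := toSigned_mem_faceStab.1 hzj
    -- `f` and `g` differ by a constant, and both vanish at this column because it lies in both
    -- faces.
    have h1 := hfg (max j k)
    rw [(hf _).2 (le_max_right _ _), (hg _).2 (le_max_left _ _)] at h1
    have : f = g := funext fun c => by
      have := hfg c
      rw [add_left_cancel h1] at this
      exact (add_right_cancel this).symm
    rwa [this]
  · intro i j h
    exact colSwap_injective (twist_eq_twist rfl rfl h).1
  · exact fun i j h => mul_sq_of_comm (coxGen_sq i) (coxGen_sq j) (coxGen_comm i j h)

/-! ### The group Sym(r) × C₂. -/

/-- Permutations of the columns as signed permutations. -/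
def colHom (r : ℕ) : Perm (Fin r) →* signedGroup r :=
  MonoidHom.mk' (fun σ => toSigned σ fun _ => 0) fun σ τ => by simp [toSigned_mul]

/-- The Coxeter generators of the symmetric group of the columns, preceded by a central
involution. -/
def colGen {r : ℕ} (i : Fin r) : Perm (Fin r) × ℤˣ := (colSwap i, if (i : ℕ) = 0 then -1 else 1)

theorem colGen_sq {r : ℕ} (i : Fin r) : colGen i ^ 2 = 1 := by
  rw [pow_two, colGen, Prod.mk_mul_mk, colSwap_sq]
  split_ifs <;> rfl

/-- The action of `Sym r × {1, -1}` on the two-row array by signed permutations. -/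
def twistCol {r : ℕ} (χ : Perm (Fin r) →* ℤˣ) (o : Fin r → Fin 2) :
    Perm (Fin r) × ℤˣ →* Perm (Fin r × Fin 2) :=
  twist ((colHom r).comp (MonoidHom.fst _ _)) (MonoidHom.snd _ _ * χ.comp (MonoidHom.fst _ _)) o

/-- Here the twist is injective: with no individual sign changes, the image determines the column
permutation and the common row shift. Lifting is then immediate. -/
theorem isStringCGroup_twistCol {r : ℕ} (hr : 0 < r) (χ : Perm (Fin r) →* ℤˣ) (o : Fin r → Fin 2)
    (hne : ∀ i, twistCol χ o (colGen i) ≠ 1) :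
    IsStringCGroup (permGroup fun i => twistCol χ o (colGen i))
      (permGens fun i => twistCol χ o (colGen i)) := by
  have hinj : ∀ x y, twistCol χ o x = twistCol χ o y → x = y := by
    rintro ⟨σ, ε⟩ ⟨τ, δ⟩ h
    obtain ⟨rfl, h2⟩ := twist_eq_twist rfl rfl h
    have := rowShift_injective (add_left_cancel (h2 ⟨0, hr⟩))
    simp only [MonoidHom.mul_apply, MonoidHom.coe_snd, MonoidHom.coe_comp, MonoidHom.coe_fst,
      Function.comp_apply, mul_left_inj] at this
    exact Prod.ext rfl this
  let Q : Fin r → Subgroup (Perm (Fin r) × ℤˣ) := fun j =>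
    (faceStab j).comap ((colHom r).comp (MonoidHom.fst _ _)) ⊓
      if (j : ℕ) = 0 then (MonoidHom.snd _ _).ker else ⊤
  have hQ : ∀ j σ ε, (σ, ε) ∈ Q j ↔
      (∀ c, j ≤ σ c ↔ j ≤ c) ∧ ((j : ℕ) = 0 → ε = 1) := by
    intro j σ ε
    have h1 : (σ, ε) ∈ (faceStab j).comap ((colHom r).comp (MonoidHom.fst _ _)) ↔
        ∀ c, j ≤ σ c ↔ j ≤ c := by
      show toSigned σ (fun _ => 0) ∈ faceStab j ↔ _
      rw [toSigned_mem_faceStab]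
      simp
    rw [Subgroup.mem_inf, h1]
    refine and_congr_right fun _ => ?_
    split_ifs with h
    · exact ⟨fun h' _ => h', fun h' => h' h⟩
    · simp [h]
  refine isStringCGroup_of_hom _ _ Q ?_ ?_ ?_ colGen_sq hne ?_ ?_
  · intro i j h
    rw [colGen, hQ]
    refine ⟨fun c => ((toSigned_mem_faceStab.1 (coxGen_mem_faceStab h)) c).1, fun hj => ?_⟩
    rw [if_neg]
    exact fun hi => h (Fin.ext (hi.trans hj.symm))
  · rintro I ⟨σ, ε⟩ hx
    -- Without sign changes `σ` also preserves face `0`, so type B_r sorting applies with generator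
    -- `0` excluded.
    have hσ : toSigned σ (fun _ => 0) ∈ Subgroup.closure (coxGen '' (I \ {⟨0, hr⟩})) := by
      refine mem_closure_coxGen _ _ fun j hj => ?_
      rw [toSigned_mem_faceStab]
      refine fun c => ⟨?_, fun _ => rfl⟩
      by_cases h0 : j = ⟨0, hr⟩
      · simp [h0, Fin.le_def]
      · exact ((hQ _ _ _).1 (hx j fun h => hj ⟨h, h0⟩)).1 c
    let π : signedGroup r →* Perm (Fin r) × ℤˣ :=
      (MonoidHom.inl _ _).comp ((MonoidHom.snd _ _).comp (signedGroup r).subtype)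
    have h1 := Subgroup.mem_map_of_mem π hσ
    rw [MonoidHom.map_closure, Set.image_image] at h1
    have h2 : (σ, 1) ∈ Subgroup.closure (colGen '' I) := by
      refine Subgroup.closure_mono ?_ h1
      rintro _ ⟨i, ⟨hi, hi0⟩, rfl⟩
      refine ⟨i, hi, ?_⟩
      have : (i : ℕ) ≠ 0 := fun h => hi0 (Fin.ext h)
      rw [colGen, if_neg this]
      rfl
    have h3 : ((1 : Perm (Fin r)), ε) ∈ Subgroup.closure (colGen '' I) := by
      rcases Int.units_eq_one_or ε with rfl | rfl
      · exact one_mem _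
      · refine Subgroup.subset_closure ⟨⟨0, hr⟩, ?_, ?_⟩
        · by_contra h0
          have := ((hQ _ _ _).1 (hx _ h0)).2 rfl
          exact absurd this (by decide)
        · rw [colGen, colSwap_of_zero _ rfl, if_pos rfl]
    simpa using mul_mem h2 h3
  · rintro I y ⟨k, hk⟩ hy
    obtain ⟨x, -, rfl⟩ := hy k hk
    refine ⟨x, fun j hj => ?_, rfl⟩
    obtain ⟨z, hzj, hz⟩ := hy j hj
    rwa [← hinj _ _ hz]
  · intro i j h
    exact colSwap_injective (congrArg Prod.fst (hinj _ _ h))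
  · refine fun i j h => mul_sq_of_comm (colGen_sq i) (colGen_sq j) ?_
    rw [colGen, colGen, Prod.mk_mul_mk, Prod.mk_mul_mk, colSwap_comm i j h, mul_comm (ite _ _ _)]

/-! ### Graphs of signed permutations. -/

theorem adj_permRepGraph_signedPerm {r : ℕ} {ρ : Fin r → Perm (Fin r × Fin 2)} {i : Fin r}
    {σ : Perm (Fin r)} {f : Fin r → Fin 2} (h : ρ i = signedPerm σ f) (c d : Fin r) (t u : Fin 2) :
    (permRepGraph ρ i).Adj (c, t) (d, u) ↔ (c, t) ≠ (d, u) ∧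
      (σ c = d ∧ t + f c = u ∨ σ d = c ∧ u + f d = t) := by
  simp [permRepGraph, h]

theorem permRepGraph_eq_ladder {r : ℕ} (ρ : Fin r → Perm (Fin r × Fin 2)) (F : Fin r → Prop)
    [DecidablePred F]
    (h : ∀ i, ρ i = signedPerm (colSwap i) fun c => if (i : ℕ) = 0 ∧ F c then 1 else 0) :
    permRepGraph ρ = ladder r F := by
  funext i
  ext ⟨c, t⟩ ⟨d, u⟩
  rw [adj_permRepGraph_signedPerm (h i)]
  simp only [ladder, SimpleGraph.fromRel_adj]
  refine and_congr_right fun hne => ?_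
  by_cases hi : (i : ℕ) = 0
  · simp only [colSwap_of_zero i hi, hi, Perm.one_apply, true_and, ne_eq, not_true_eq_false,
      false_and, or_false]
    by_cases hcd : c = d
    · subst hcd
      have htu : t ≠ u := fun h => hne (by rw [h])
      by_cases hF : F c
      · have key : ∀ t u : Fin 2, t ≠ u → t + 1 = u ∨ u + 1 = t := by decide
        simpa [hF] using key t u htu
      · simp [hF, htu, htu.symm]
    · simp [hcd, Ne.symm hcd]
  · simp only [hi, false_and, if_false, add_zero, Fin.ext_iff, colSwap_val, ne_eq,
      not_false_eq_true, true_and, false_or]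
    simp only [ne_eq, Prod.mk.injEq, Fin.ext_iff] at hne
    split_ifs <;> omega

theorem permRepGraph_eq_twistedLadder {r : ℕ} (ρ : Fin r → Perm (Fin r × Fin 2)) (F : Fin r → Prop)
    [DecidablePred F]
    (h : ∀ i, ρ i = signedPerm (colSwap i) fun c => if (i : ℕ) = 0 then (if F c then 1 else 0)
      else if (c : ℕ) + 1 = i ∨ (c : ℕ) = i then 0 else 1) :
    permRepGraph ρ = twistedLadder r F := by
  funext i
  by_cases hi : (i : ℕ) = 0
  · have h1 := permRepGraph_eq_ladder (fun j => signedPerm (colSwap j) fun c =>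
      if (j : ℕ) = 0 ∧ F c then 1 else 0) F fun _ => rfl
    have h2 : twistedLadder r F i = ladder r F i := by
      ext a b
      simp [twistedLadder, hi]
    rw [h2, ← h1]
    simp [permRepGraph, h, hi]
  ext ⟨c, t⟩ ⟨d, u⟩
  rw [adj_permRepGraph_signedPerm (h i)]
  simp only [twistedLadder, ladder, SimpleGraph.sup_adj, SimpleGraph.fromRel_adj, ← and_or_left]
  refine and_congr_right fun hne => ?_
  simp only [hi, false_and, if_false, Fin.ext_iff, colSwap_val, ne_eq, not_false_eq_true, true_and,
    false_or]
  simp only [ne_eq, Prod.mk.injEq, Fin.ext_iff] at hne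
  by_cases hc : (c : ℕ) + 1 = i ∨ (c : ℕ) = i <;> by_cases hd : (d : ℕ) + 1 = i ∨ (d : ℕ) = i
  all_goals
    simp only [hc, hd, if_true, if_false, add_zero, Fin.val_add, Fin.val_one]
    split_ifs <;> omega

theorem signedPerm_colSwap_ne_one {r : ℕ} {i : Fin r} {f : Fin r → Fin 2}
    (h : (i : ℕ) = 0 → ∃ c, f c ≠ 0) : signedPerm (colSwap i) f ≠ 1 := by
  intro h1
  rw [← signedPerm_one] at h1
  obtain ⟨h2, rfl⟩ := signedPerm_inj h1
  have hr : 0 < r := i.pos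
  rw [← colSwap_of_zero ⟨0, hr⟩ rfl] at h2
  obtain ⟨c, hc⟩ := h (congrArg Fin.val (colSwap_injective h2))
  exact hc rfl

theorem givesStringCGroup_ladder {r : ℕ} (τ : Fin r → Perm (Fin r × Fin 2)) (F : Fin r → Prop)
    [DecidablePred F] (hF : ∃ c, F c)
    (h : ∀ i, τ i = signedPerm (colSwap i) fun c => if (i : ℕ) = 0 ∧ F c then 1 else 0)
    (hs : (∀ i, τ i ≠ 1) → IsStringCGroup (permGroup τ) (permGens τ)) :
    GivesStringCGroup (ladder r F) := by
  refine givesStringCGroup_of_exists τ (permRepGraph_eq_ladder τ F h) (hs fun i => ?_)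
  rw [h]
  obtain ⟨c, hc⟩ := hF
  exact signedPerm_colSwap_ne_one fun hi => ⟨c, by simp [hi, hc]⟩

theorem givesStringCGroup_twistedLadder {r : ℕ} (τ : Fin r → Perm (Fin r × Fin 2))
    (F : Fin r → Prop) [DecidablePred F] (hF : ∃ c, F c)
    (h : ∀ i, τ i = signedPerm (colSwap i) fun c => if (i : ℕ) = 0 then (if F c then 1 else 0)
      else if (c : ℕ) + 1 = i ∨ (c : ℕ) = i then 0 else 1)
    (hs : (∀ i, τ i ≠ 1) → IsStringCGroup (permGroup τ) (permGens τ)) :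
    GivesStringCGroup (twistedLadder r F) := by
  refine givesStringCGroup_of_exists τ (permRepGraph_eq_twistedLadder τ F h) (hs fun i => ?_)
  rw [h]
  obtain ⟨c, hc⟩ := hF
  exact signedPerm_colSwap_ne_one fun hi => ⟨c, by simp [hi, hc]⟩

/-! ### Parities, characters, and the six graphs. -/

/-- The parity of the number of a column. -/
def colParity {r : ℕ} (c : Fin r) : Fin 2 := if Even (c : ℕ) then 0 else 1

theorem colParity_add {r : ℕ} (i c : Fin r) : colParity c + colParity (colSwap i c) =
    if (i : ℕ) ≠ 0 ∧ ((c : ℕ) + 1 = i ∨ (c : ℕ) = i) then 1 else 0 := by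
  by_cases hi : (i : ℕ) = 0
  · simp [hi, colSwap_of_zero i hi, fin_two_add_self]
  unfold colParity
  rw [colSwap_val]
  by_cases h1 : (c : ℕ) + 1 = i
  · rw [if_pos h1, ← h1]
    by_cases hc : Even (c : ℕ) <;> simp [hc, Nat.even_add_one]
  rw [if_neg h1]
  by_cases h2 : c = i
  · subst h2
    obtain ⟨k, hk⟩ := Nat.exists_eq_succ_of_ne_zero hi
    rw [if_pos rfl, hk]
    by_cases hc : Even k <;> simp [hc, Nat.even_add_one]
  · rw [if_neg h2, fin_two_add_self, if_neg]
    rintro ⟨-, h | h⟩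
    · exact h1 h
    · exact h2 (Fin.ext h)

/-- The sign of the permutation of the columns. -/
def colSign (r : ℕ) : signedGroup r →* ℤˣ :=
  Perm.sign.comp ((MonoidHom.snd _ _).comp (signedGroup r).subtype)

/-- The sign of the permutation of the two-row array. -/
def arraySign (r : ℕ) : signedGroup r →* ℤˣ :=
  Perm.sign.comp ((MonoidHom.fst _ _).comp (signedGroup r).subtype)

theorem colSign_coxGen {r : ℕ} (i : Fin r) :
    colSign r (coxGen i) = if (i : ℕ) = 0 then 1 else -1 := sign_colSwap i

/-- Generator `0` is one transposition of vertices; the others act as the same transposition in both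
rows, so their signs cancel. -/
theorem arraySign_coxGen {r : ℕ} (i : Fin r) :
    arraySign r (coxGen i) = if (i : ℕ) = 0 then -1 else 1 := by
  have h : arraySign r (coxGen i) = Perm.sign (signedPerm (colSwap i)
      fun c => if (i : ℕ) = 0 ∧ (c : ℕ) = 0 then 1 else 0) := rfl
  rw [h]
  split_ifs with hi
  · have : signedPerm (colSwap i) (fun c => if (i : ℕ) = 0 ∧ (c : ℕ) = 0 then 1 else 0)
        = swap (i, 0) (i, 1) := by
      ext1 ⟨c, t⟩
      have hc : (c : ℕ) = 0 ↔ c = i := by rw [Fin.ext_iff, hi]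
      simp only [signedPerm_apply, colSwap_of_zero i hi, Perm.one_apply, hi, true_and, hc,
        swap_apply_def, Prod.mk.injEq]
      by_cases h : c = i
      · subst h
        revert t
        simp [Fin.forall_fin_two]
      · simp [h]
    rw [this]
    exact Perm.sign_swap (by simp)
  · have : signedPerm (colSwap i) (fun c => if (i : ℕ) = 0 ∧ (c : ℕ) = 0 then 1 else 0)
        = prodCongrLeft fun _ : Fin 2 => colSwap i := by
      ext1 ⟨c, t⟩
      simp [hi]
    rw [this, Perm.sign_prodCongrLeft]
    simp

theorem rowShift_one : rowShift 1 = 0 := rfl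

theorem rowShift_neg_one : rowShift (-1) = 1 := rfl

theorem mainTheorem5 (r : ℕ) (hr : 1 ≤ r) :
    GivesStringCGroup (graph1 r) ∧
    GivesStringCGroup (graph2 r) ∧
    GivesStringCGroup (graph13 r) ∧
    (2 ≤ r → GivesStringCGroup (graph14 r)) ∧
    GivesStringCGroup (graph15 r) ∧
    (Even r → GivesStringCGroup (graph16 r)) := by
  have h0 : ∃ c : Fin r, (c : ℕ) = 0 := ⟨⟨0, hr⟩, rfl⟩
  have h1 : 2 ≤ r → ∃ c : Fin r, (c : ℕ) ≠ 0 := fun h => ⟨⟨1, h⟩, one_ne_zero⟩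
  refine ⟨?_, ?_, ?_, fun h => ?_, ?_, fun h => ?_⟩
  · refine givesStringCGroup_ladder _ _ ⟨⟨0, hr⟩, trivial⟩ (fun i => ?_)
      (isStringCGroup_twistCol hr 1 fun _ => 0)
    rw [twistCol, twist_apply _ _ _ (σ := colSwap i) (f := fun _ => 0) rfl]
    congr 1
    funext c
    by_cases hi : (i : ℕ) = 0 <;> simp [colGen, hi, rowShift_one, rowShift_neg_one]
  · refine givesStringCGroup_twistedLadder _ _ ⟨⟨0, hr⟩, trivial⟩ (fun i => ?_)
      (isStringCGroup_twistCol hr Perm.sign colParity)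
    rw [twistCol, twist_apply _ _ _ (σ := colSwap i) (f := fun _ => 0) rfl]
    congr 1
    funext c
    rw [colParity_add]
    by_cases hi : (i : ℕ) = 0
    · simp [colGen, hi, sign_colSwap, rowShift_neg_one]
    · by_cases hc : (c : ℕ) + 1 = i ∨ (c : ℕ) = i <;>
        simp [colGen, hi, hc, sign_colSwap, rowShift_neg_one, fin_two_add_self]
  · refine givesStringCGroup_ladder _ _ h0 (fun i => ?_)
      (isStringCGroup_twist_id 1 fun _ => 0)
    rw [twist_apply _ _ _ rfl]
    simp [rowShift_one]
  -- `arraySign` is -1 at generator `0` only, where the interchange complements the set of columns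
  -- with a vertical edge.
  · refine givesStringCGroup_ladder _ _ (h1 h) (fun i => ?_)
      (isStringCGroup_twist_id (arraySign r) fun _ => 0)
    rw [twist_apply _ _ _ rfl, arraySign_coxGen]
    congr 1
    funext c
    by_cases hi : (i : ℕ) = 0 <;> by_cases hc : (c : ℕ) = 0 <;>
      simp [hi, hc, rowShift_one, rowShift_neg_one, fin_two_add_self]
  · refine givesStringCGroup_twistedLadder _ _ h0 (fun i => ?_)
      (isStringCGroup_twist_id (colSign r) colParity)
    rw [twist_apply _ _ _ rfl, colSign_coxGen]
    congr 1
    funext c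
    rw [colParity_add]
    by_cases hi : (i : ℕ) = 0
    · simp [hi, rowShift_one]
    · by_cases hc : (c : ℕ) + 1 = i ∨ (c : ℕ) = i <;>
        simp [hi, hc, rowShift_neg_one, fin_two_add_self]
  -- The product of the two characters is -1 at every generator.
  · refine givesStringCGroup_twistedLadder _ _ (h1 (by obtain ⟨k, rfl⟩ := h; omega)) (fun i => ?_)
      (isStringCGroup_twist_id (colSign r * arraySign r) colParity)
    rw [twist_apply _ _ _ rfl, MonoidHom.mul_apply, colSign_coxGen, arraySign_coxGen]
    congr 1
    funext c
    rw [colParity_add]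
    by_cases hi : (i : ℕ) = 0
    · by_cases hc : (c : ℕ) = 0 <;> simp [hi, hc, rowShift_neg_one, fin_two_add_self]
    · by_cases hc : (c : ℕ) + 1 = i ∨ (c : ℕ) = i <;>
        simp [hi, hc, rowShift_neg_one, fin_two_add_self]
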